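/- Let $G=(V,E)$ be a directed network with finitely many links (parallel links allowed), and let $\mathcal P$ be the set of loop-free paths from a source node to a destination node, each path being identified with its set of links. Link $i\in E$ has an unknown success probability $\theta_i\in(0,1]$. A packet sent on a path $p$ suffers a delay $d_i$ on each link $i\in p$. All these delays are independent, over links and over packets, and $d_i$ is geometric on $\{1,2,\dots\}$ with parameter $\theta_i$. Put $D_\theta(p)=\sum_{i\in p}1/\theta_i$. A (source routing, semi-bandit) policy $\pi$ chooses, possibly at random and without knowledge of $\theta$, the path $p^\pi(n)$ of the $n$-th packet as a function of the paths of the first $n-1$ packets and of their delays on each link of these paths. It is uniformly good if, for every $\theta\in(0,1]^E$ and every $\alpha>0$, the expected number of packets among the first $n$ that are sent on paths $p$ with $D_\theta(p)>\min_{q\in\mathcal P}D_\theta(q)$ is $o(n^\alpha)$ as $n\to\infty$. Let $\theta\in(0,1]^E$ be such that the path $p^\star$ that minimises $D_\theta$ over $\mathcal P$ is unique, and put $\Delta_p=D_\theta(p)-D_\theta(p^\star)$ and $$R^\pi(N)=\mathbb E_\theta\Big[\sum_{n=1}^N D^\pi(n)\Big]-N\,D_\theta(p^\star),$$ where $D^\pi(n)$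 is the end-to-end delay of the $n$-th packet under $\pi$. Then every uniformly good policy $\pi$ satisfies $$\liminf_{N\to\infty}\frac{R^\pi(N)}{\log N}\ \ge\ C_2(\theta),$$ where $C_2(\theta)$ is the value of the semi-infinite linear program $$\inf_{x\ge 0}\ \sum_{p\in\mathcal P}x_p\Delta_p\quad\text{subject to}\quad \inf_{\lambda\in B_2(\theta)}\ \sum_{p\ne p^\star}x_p\sum_{i\in p}\mathrm{KLG}(\theta_i,\lambda_i)\ \ge\ 1,$$ with $$B_2(\theta)=\Big\{\lambda\in(0,1]^E:\ \lambda_i=\theta_i\ \text{for all } i\in p^\star,\ \ \min_{p\in\mathcal P}D_\lambda(p)<D_\lambda(p^\star)\Big\},$$ and where $\mathrm{KLG}(u,v)=\sum_{k\ge1}u(1-u)^{k-1}\log\frac{u(1-u)^{k-1}}{v(1-v)^{k-1}}\in[0,\infty]$ is the Kullback--Leibler divergence between the geometric distributions on $\{1,2,\dots\}$ with parameters $u$ and $v$ (with $0\cdot\infty=0$ and $\inf\emptyset=+\infty$). -/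

import Mathlib

open MeasureTheory ProbabilityTheory Filter Topology Asymptotics
open scoped ENNReal NNReal

noncomputable section

namespace OnlineRouting

/-- A directed network with nodes `V` and links `E` (parallel links are allowed). -/
structure Network (V E : Type*) where
  /-- the node at which a link starts -/
  src : E → V
  /-- the node at which a link ends -/
  tgt : E → V

/-- `G.IsWalk u l v`: the links of the list `l`, taken in this order, lead from `u` to `v`. -/
def Network.IsWalk {V E : Type*} (G : Network V E) : V → List E → V → Prop
  | u, [], v => u = v
  | u, e :: l, v => G.src e = u ∧ G.IsWalk (G.tgt e) l v

/-- The set of links `p` is the set of links of a loop-free path from `s` to `t`: a walk that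
visits no node twice (the visited nodes are `s` and the end points of the links used). -/
def Network.IsPath {V E : Type*} (G : Network V E) (s t : V) (p : Finset E) : Prop :=
  ∃ l : List E, G.IsWalk s l t ∧ (s :: l.map G.tgt).Nodup ∧ ∀ i : E, i ∈ p ↔ i ∈ l

/-- The set of loop-free paths from `s` to `t`, each given as its set of links. -/
def Network.Path {V E : Type*} (G : Network V E) (s t : V) : Type _ :=
  {p : Finset E // G.IsPath s t p}

/-- The set of links of a path. -/
def Network.Path.links {V E : Type*} {G : Network V E} {s t : V} (p : G.Path s t) : Finset E :=
  p.1

instance {V E : Type*} [Fintype E] (G : Network V E) (s t : V) : Finite (G.Path s t) :=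
  inferInstanceAs (Finite {p : Finset E // G.IsPath s t p})

instance {V E : Type*} [Fintype E] (G : Network V E) (s t : V) : Fintype (G.Path s t) :=
  Fintype.ofFinite _

instance {V E : Type*} (G : Network V E) (s t : V) : MeasurableSpace (G.Path s t) := ⊤

instance {V E : Type*} (G : Network V E) (s t : V) : DiscreteMeasurableSpace (G.Path s t) :=
  ⟨fun _ => trivial⟩

/-- Vectors of success probabilities of the links, each in `(0, 1]`. -/
abbrev Param (E : Type*) : Type _ := E → Set.Ioc (0 : ℝ) 1

/-- The law of the delay of a link with success probability `u`: the geometric distribution on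
`{1, 2, …}`, with mass `u * (1 - u) ^ (k - 1)` at `k` (Mathlib's one counts failures only). -/
def linkDelay (u : Set.Ioc (0 : ℝ) 1) : Measure ℕ :=
  (geometricMeasure ⟨(u : ℝ), u.2.1.le, u.2.2⟩).map (fun k => k + 1)

instance (u : Set.Ioc (0 : ℝ) 1) : IsProbabilityMeasure (linkDelay u) :=
  Measure.isProbabilityMeasure_map (measurable_of_countable _).aemeasurable

/-- The Kullback-Leibler divergence between the geometric distributions (on `{1, 2, …}`) with
parameters `u` and `v`; it is `∞` if `v = 1` and `u < 1`. -/
def KLG (u v : Set.Ioc (0 : ℝ) 1) : ℝ≥0∞ :=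
  InformationTheory.klDiv (linkDelay u) (linkDelay v)

/-- The mean delay `∑ i ∈ p, 1 / θ i` of the path `p`. -/
def meanDelay {V E : Type*} {G : Network V E} {s t : V} (θ : Param E) (p : G.Path s t) : ℝ :=
  ∑ i ∈ p.links, 1 / (θ i : ℝ)

/-- What the source records for one packet: the path used and the delays of its links. Delays of
links outside the path are not observed; by convention these components are `0`. -/
abbrev Step {V E : Type*} (G : Network V E) (s t : V) : Type _ := G.Path s t × (E → ℕ)

/-- The records of the first `n` packets. -/
abbrev History {V E : Type*} (G : Network V E) (s t : V) (n : ℕ) : Type _ :=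
  Fin n → Step G s t

/-- A (possibly randomized) source routing policy with semi-bandit feedback: given the paths and
the per-link delays on these paths of the first `n` packets, the conditional distribution of the
path of the next packet. It does not depend on the link parameters. -/
structure Policy {V E : Type*} (G : Network V E) (s t : V) where
  /-- the distribution of the path of the packet after the first `n` packets -/
  choose : (n : ℕ) → Kernel (History G s t n) (G.Path s t)
  /-- these are probability distributions -/
  isMarkov : ∀ n, IsMarkovKernel (choose n)

open Classical in
/-- The law of the recorded link delays of a packet sent on the path `p`: independent geometric
delays on the links of `p`, and `0` elsewhere. -/
def delayLaw {V E : Type*} [Fintype E] {G : Network V E} {s t : V} (θ : Param E)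
    (p : G.Path s t) : Measure (E → ℕ) :=
  Measure.pi fun i => if i ∈ p.links then linkDelay (θ i) else Measure.dirac 0

/-- The conditional law of the record of the next packet given the first `n` records: the path is
drawn by the policy, then the delays on this path, independently of the past. -/
def stepKernel {V E : Type*} [Fintype E] {G : Network V E} {s t : V} (θ : Param E)
    (π : Policy G s t) (n : ℕ) : Kernel (History G s t n) (Step G s t) :=
  (π.choose n).compProd
    (Kernel.ofFunOfCountable fun x : History G s t n × G.Path s t => delayLaw θ x.2)

/-- The law of the records of the first `n` packets under the policy `π` and parameter `θ`. -/
def historyLaw {V E : Type*} [Fintype E] {G : Network V E} {s t : V} (θ : Param E)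
    (π : Policy G s t) : (n : ℕ) → Measure (History G s t n)
  | 0 => Measure.dirac Fin.elim0
  | n + 1 => ((historyLaw θ π n).compProd (stepKernel θ π n)).map
      fun x => Fin.snoc (α := fun _ => Step G s t) x.1 x.2

/-- The regret of `π` up to packet `N`: the expected total end-to-end delay of the first `N`
packets, minus `N` times the mean delay of the path `pstar`. -/
def regret {V E : Type*} [Fintype E] {G : Network V E} {s t : V} (θ : Param E)
    (pstar : G.Path s t) (π : Policy G s t) (N : ℕ) : ℝ :=
  (∫ h, ∑ k : Fin N, ∑ i ∈ (h k).1.links, ((h k).2 i : ℝ) ∂(historyLaw θ π N))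
    - N * meanDelay θ pstar

/-- The path `p` is sub-optimal under the parameter `θ`. -/
def Suboptimal {V E : Type*} {G : Network V E} {s t : V} (θ : Param E) (p : G.Path s t) : Prop :=
  ∃ q : G.Path s t, meanDelay θ q < meanDelay θ p

open Classical in
/-- The expected number of packets sent on sub-optimal paths among the first `n` packets. -/
def expectedSuboptimal {V E : Type*} [Fintype E] {G : Network V E} {s t : V} (θ : Param E)
    (π : Policy G s t) (n : ℕ) : ℝ :=
  ∫ h, ((Finset.univ.filter fun k : Fin n => Suboptimal θ (h k).1).card : ℝ)
    ∂(historyLaw θ π n)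

/-- The policy `π` is uniformly good: for every parameter and every `α > 0`, the expected number
of packets sent on sub-optimal paths among the first `n` packets is `o(n ^ α)`. -/
def UniformlyGood {V E : Type*} [Fintype E] {G : Network V E} {s t : V}
    (π : Policy G s t) : Prop :=
  ∀ (θ : Param E) (α : ℝ), 0 < α →
    (fun n : ℕ => expectedSuboptimal θ π n) =o[atTop] (fun n : ℕ => (n : ℝ) ^ α)

/-- The bad parameters: those which agree with `θ` on `pstar` and under which `pstar` is not
optimal, that is, the least mean delay of a path is smaller than that of `pstar`. -/
def badParams {V E : Type*} {G : Network V E} {s t : V} (θ : Param E) (pstar : G.Path s t) :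
    Set (Param E) :=
  {μ | (∀ i ∈ pstar.links, μ i = θ i) ∧ ∃ p : G.Path s t, meanDelay μ p < meanDelay μ pstar}

open Classical in
/-- Feasibility of `x ≥ 0` in the linear program:
`inf over bad μ of ∑ p ≠ pstar, x p * ∑ i ∈ p, KLG (θ i) (μ i)` is at least `1`. -/
def Feasible {V E : Type*} [Fintype E] {G : Network V E} {s t : V} (θ : Param E)
    (pstar : G.Path s t) (x : G.Path s t → ℝ≥0) : Prop :=
  1 ≤ ⨅ μ ∈ badParams θ pstar,
    ∑ p ∈ Finset.univ.filter (fun p : G.Path s t => p ≠ pstar),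
      (x p : ℝ≥0∞) * ∑ i ∈ p.links, KLG (θ i) (μ i)

/-- The value of the linear program: the infimum of `∑ p, x p * Δ p` over the feasible `x`, where
`Δ p` is the mean delay of `p` minus that of `pstar` (and `+∞` if no `x` is feasible). -/
def lowerBoundConst {V E : Type*} [Fintype E] {G : Network V E} {s t : V} (θ : Param E)
    (pstar : G.Path s t) : EReal :=
  ⨅ (x : G.Path s t → ℝ≥0) (_ : Feasible θ pstar x),
    ((∑ p : G.Path s t, (x p : ℝ) * (meanDelay θ p - meanDelay θ pstar) : ℝ) : EReal)

end OnlineRouting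

end

noncomputable section

namespace OnlineRouting

/-! ### The geometric delay of a link -/

/-! Fix a bad parameter `μ` with finite divergences from `θ`. The law of the policy's choices given
the past is the same under `θ` and `μ`, so only observed delays enter the likelihood ratio, and its
expected logarithm under `θ` is the information: the sum over `p` of the expected count of `p` times
`pathInfo θ μ p`. Since `μ = θ` on `pstar`, that path contributes nothing.

A uniformly good policy uses `pstar` for a fraction of packets tending to 1 under `θ`, but only `o(N
^ α)` times under `μ`, where `pstar` is suboptimal. The change of measure
`lintegral_mul_exp_neg_historyLLR_le`, combined with `1 + x ≤ exp x`, turns this contrast into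
`mul_expectedCount_le`; taking `c = (1 - α) log N` there gives information at least `(1 - α + o(1))
log N` (`exists_lower_bound_info`).

The regret is the sum of the expected counts weighted by the gaps (`regret_eq`), so the counts
divided by `log N` are asymptotically feasible for the linear program, at cost regret over `log N`.
Compactness (`lowerBoundConst_le_of_frequently`) replaces them by a limit point, feasible against
all bad `μ` at once. Infinite divergences are removed by lowering the corresponding `μ i` slightly
below 1 (`exists_badParams_KLG_ne_top`). -/

lemma success_ne_zero (u : Set.Ioc (0 : ℝ) 1) :
    (⟨(u : ℝ), u.2.1.le, u.2.2⟩ : unitInterval) ≠ 0 :=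
  fun h => u.2.1.ne' (congrArg Subtype.val h)

lemma linkDelay_singleton_succ (u : Set.Ioc (0 : ℝ) 1) (n : ℕ) :
    linkDelay u {n + 1} = ENNReal.ofReal ((1 - (u : ℝ)) ^ n * u) := by
  rw [linkDelay, Measure.map_apply (measurable_of_countable _) (measurableSet_singleton _)]
  have : (fun k : ℕ => k + 1) ⁻¹' {n + 1} = {n} := by ext; simp
  rw [this, geometricMeasure_singleton (success_ne_zero u)]

lemma linkDelay_singleton_zero (u : Set.Ioc (0 : ℝ) 1) : linkDelay u {0} = 0 := by
  rw [linkDelay, Measure.map_apply (measurable_of_countable _) (measurableSet_singleton _)]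
  have : (fun k : ℕ => k + 1) ⁻¹' {0} = ∅ := by ext; simp
  rw [this, measure_empty]

lemma integrable_linkDelay_iff (u : Set.Ioc (0 : ℝ) 1) (f : ℕ → ℝ) :
    Integrable f (linkDelay u) ↔ Summable fun n => (1 - (u : ℝ)) ^ n * u * ‖f (n + 1)‖ := by
  rw [linkDelay, integrable_map_measure (by fun_prop) (by fun_prop),
    integrable_geometricMeasure_iff (success_ne_zero u)]
  rfl

lemma hasSum_linkDelay_mean (u : Set.Ioc (0 : ℝ) 1) :
    HasSum (fun n : ℕ => (1 - (u : ℝ)) ^ n * u * ((n : ℝ) + 1)) (1 / (u : ℝ)) := by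
  have h0 := u.2.1
  have h1 := u.2.2
  have hr : ‖1 - (u : ℝ)‖ < 1 := by
    rw [Real.norm_eq_abs, abs_lt]; constructor <;> linarith
  have h := ((hasSum_coe_mul_geometric_of_norm_lt_one hr).add
    (hasSum_geometric_of_norm_lt_one hr)).mul_left (u : ℝ)
  have hval : (u : ℝ) * ((1 - u) / (1 - (1 - u)) ^ 2 + (1 - (1 - (u : ℝ)))⁻¹) = 1 / u := by
    rw [show (1 : ℝ) - (1 - u) = u by ring]
    field_simp
    ring
  rw [hval] at h
  have hfun : (fun n : ℕ => (1 - (u : ℝ)) ^ n * u * ((n : ℝ) + 1)) =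
      fun n : ℕ => (u : ℝ) * (n * (1 - (u : ℝ)) ^ n + (1 - (u : ℝ)) ^ n) := by
    ext n; ring
  rwa [hfun]

lemma integrable_linkDelay_id (u : Set.Ioc (0 : ℝ) 1) :
    Integrable (fun k : ℕ => (k : ℝ)) (linkDelay u) := by
  rw [integrable_linkDelay_iff]
  convert (hasSum_linkDelay_mean u).summable using 2 with n
  rw [Real.norm_of_nonneg (by positivity)]; push_cast; ring

lemma integral_linkDelay_id (u : Set.Ioc (0 : ℝ) 1) :
    ∫ k : ℕ, (k : ℝ) ∂linkDelay u = 1 / (u : ℝ) := by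
  rw [linkDelay, integral_map (by fun_prop) (by fun_prop), integral_geometricMeasure (success_ne_zero u),
    ← (hasSum_linkDelay_mean u).tsum_eq]
  simp

lemma rnDeriv_mul_singleton {α : Type*} [MeasurableSpace α] [MeasurableSingletonClass α]
    {μ ν : Measure α} [SigmaFinite μ] [SigmaFinite ν] (h : μ ≪ ν) (a : α) :
    μ.rnDeriv ν a * ν {a} = μ {a} := by
  conv_rhs => rw [← Measure.withDensity_rnDeriv_eq μ ν h]
  rw [withDensity_apply _ (measurableSet_singleton a), lintegral_singleton]

/-- Equality holds at atoms of `μ`; elsewhere the left side is 0. The inequality is all the change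
of measure needs, so `ν ≪ μ` is not required. -/
lemma exp_neg_llr_mul_singleton_le {α : Type*} [MeasurableSpace α] [MeasurableSingletonClass α]
    {μ ν : Measure α} [IsFiniteMeasure μ] [IsFiniteMeasure ν] (h : μ ≪ ν) (a : α) :
    ENNReal.ofReal (Real.exp (-llr μ ν a)) * μ {a} ≤ ν {a} := by
  rcases eq_or_ne (μ {a}) 0 with h0 | h0
  · simp [h0]
  have hm := rnDeriv_mul_singleton h a
  have hr0 : μ.rnDeriv ν a ≠ 0 := by rintro h'; rw [h', zero_mul] at hm; exact h0 hm.symm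
  have hν0 : ν {a} ≠ 0 := by rintro h'; rw [h', mul_zero] at hm; exact h0 hm.symm
  have hrt : μ.rnDeriv ν a ≠ ∞ := by
    rintro h'; rw [h', ENNReal.top_mul hν0] at hm; exact measure_ne_top μ {a} hm.symm
  rw [llr_def, Real.exp_neg, Real.exp_log (ENNReal.toReal_pos hr0 hrt),
    ENNReal.ofReal_inv_of_pos (ENNReal.toReal_pos hr0 hrt), ENNReal.ofReal_toReal hrt, ← hm,
    ← mul_assoc, ENNReal.inv_mul_cancel hr0 hrt, one_mul]

lemma linkDelay_absolutelyContinuous {u v : Set.Ioc (0 : ℝ) 1} (hv : (v : ℝ) < 1) :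
    linkDelay u ≪ linkDelay v := by
  refine Measure.AbsolutelyContinuous.mk fun s _ hs => ?_
  rw [← Set.biUnion_of_singleton s, measure_biUnion_null_iff s.to_countable]
  intro k hk
  rcases k with _ | n
  · exact linkDelay_singleton_zero u
  · have h0 : linkDelay v {n + 1} = 0 :=
      measure_mono_null (Set.singleton_subset_iff.2 hk) hs
    rw [linkDelay_singleton_succ, ENNReal.ofReal_eq_zero] at h0
    have : 0 < (1 - (v : ℝ)) ^ n * v := mul_pos (pow_pos (by linarith) n) v.2.1
    linarith

lemma integrable_llr_linkDelay {u v : Set.Ioc (0 : ℝ) 1} (hv : (v : ℝ) < 1) :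
    Integrable (llr (linkDelay u) (linkDelay v)) (linkDelay u) := by
  have hu0 := u.2.1
  have hv0 := v.2.1
  rw [integrable_linkDelay_iff]
  -- For `u = 1` only the delay 1 has mass. For `u < 1` the log-likelihood ratio is affine in the
  -- delay, hence dominated by a multiple of it, which has finite mean.
  rcases eq_or_lt_of_le u.2.2 with hu | hu
  · refine summable_of_ne_finset_zero (s := {0}) fun n hn => ?_
    simp only [Finset.mem_singleton] at hn
    simp [hu, hn]
  have key : ∀ n : ℕ, llr (linkDelay u) (linkDelay v) (n + 1) =
      n * Real.log ((1 - u) / (1 - v)) + Real.log (u / v) := by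
    intro n
    have hm := rnDeriv_mul_singleton (linkDelay_absolutelyContinuous (u := u) hv) (n + 1)
    rw [linkDelay_singleton_succ, linkDelay_singleton_succ] at hm
    have hvp : 0 < (1 - (v : ℝ)) ^ n * v := mul_pos (pow_pos (by linarith) n) hv0
    have hup : 0 < (1 - (u : ℝ)) ^ n * u := mul_pos (pow_pos (by linarith) n) hu0
    have hm' := congrArg ENNReal.toReal hm
    rw [ENNReal.toReal_mul, ENNReal.toReal_ofReal hvp.le, ENNReal.toReal_ofReal hup.le,
      ← eq_div_iff hvp.ne'] at hm'
    have h1 : (0 : ℝ) < (1 - u) / (1 - v) := div_pos (by linarith) (by linarith)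
    rw [llr_def]
    beta_reduce
    rw [hm', ← Real.log_pow, ← Real.log_mul (pow_pos h1 n).ne' (div_pos hu0 hv0).ne',
      div_pow, div_mul_div_comm]
  refine Summable.of_nonneg_of_le (fun n => ?_) (fun n => ?_)
    ((hasSum_linkDelay_mean u).summable.mul_right
      (|Real.log ((1 - u) / (1 - v))| + |Real.log (u / v)|))
  · have : 0 ≤ 1 - (u : ℝ) := by linarith
    positivity
  · have : 0 ≤ 1 - (u : ℝ) := by linarith
    rw [mul_assoc _ ((n : ℝ) + 1)]
    refine mul_le_mul_of_nonneg_left ?_ (by positivity)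
    rw [key, Real.norm_eq_abs]
    refine (abs_add_le _ _).trans ?_
    rw [abs_mul, abs_of_nonneg (Nat.cast_nonneg n)]
    have hn : (0 : ℝ) ≤ n := Nat.cast_nonneg n
    nlinarith [abs_nonneg (Real.log ((1 - u) / (1 - v))), abs_nonneg (Real.log (u / v)),
      mul_nonneg hn (abs_nonneg (Real.log (u / v)))]

lemma KLG_ne_top {u v : Set.Ioc (0 : ℝ) 1} (hv : (v : ℝ) < 1) : KLG u v ≠ ∞ :=
  InformationTheory.klDiv_ne_top (linkDelay_absolutelyContinuous hv) (integrable_llr_linkDelay hv)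

@[simp]
lemma KLG_self (u : Set.Ioc (0 : ℝ) 1) : KLG u u = 0 :=
  InformationTheory.klDiv_self _

lemma integral_llr_linkDelay {u v : Set.Ioc (0 : ℝ) 1} (h : KLG u v ≠ ∞) :
    ∫ k, llr (linkDelay u) (linkDelay v) k ∂linkDelay u = (KLG u v).toReal := by
  rw [KLG, InformationTheory.toReal_klDiv_of_measure_eq
    (InformationTheory.klDiv_ne_top_iff.1 h).1 (by simp)]

section Law

variable {V E : Type*} [Fintype E] {G : Network V E} {s t : V}

/-! ### The law of the record of one packet -/

instance (θ : Param E) (p : G.Path s t) : IsProbabilityMeasure (delayLaw θ p) := by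
  classical
  have (i : E) : IsProbabilityMeasure
      (if i ∈ p.links then linkDelay (θ i) else Measure.dirac 0) := by
    split_ifs <;> infer_instance
  unfold delayLaw
  convert! (inferInstance : IsProbabilityMeasure (Measure.pi fun i =>
    if i ∈ p.links then linkDelay (θ i) else Measure.dirac 0))

lemma measurePreserving_delayLaw (θ : Param E) (p : G.Path s t) {i : E} (hi : i ∈ p.links) :
    MeasurePreserving (fun y : E → ℕ => y i) (delayLaw θ p) (linkDelay (θ i)) := by
  classical
  have (i : E) : IsProbabilityMeasure
      (if i ∈ p.links then linkDelay (θ i) else Measure.dirac 0) := by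
    split_ifs <;> infer_instance
  have h := measurePreserving_eval
    (fun i => if i ∈ p.links then linkDelay (θ i) else Measure.dirac 0) i
  rw [if_pos hi] at h
  unfold delayLaw
  convert! h

lemma integrable_delayLaw_sum (θ : Param E) (p : G.Path s t) {f : E → ℕ → ℝ}
    (hf : ∀ i ∈ p.links, Integrable (f i) (linkDelay (θ i))) :
    Integrable (fun y => ∑ i ∈ p.links, f i (y i)) (delayLaw θ p) :=
  integrable_finsetSum _ fun i hi =>
    (measurePreserving_delayLaw θ p hi).integrable_comp_of_integrable (hf i hi)

lemma integral_delayLaw_sum (θ : Param E) (p : G.Path s t) {f : E → ℕ → ℝ}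
    (hf : ∀ i ∈ p.links, Integrable (f i) (linkDelay (θ i))) :
    ∫ y, ∑ i ∈ p.links, f i (y i) ∂delayLaw θ p =
      ∑ i ∈ p.links, ∫ k, f i k ∂linkDelay (θ i) := by
  have hint (i : E) (hi : i ∈ p.links) : Integrable (fun y => f i (y i)) (delayLaw θ p) :=
    (measurePreserving_delayLaw θ p hi).integrable_comp_of_integrable (hf i hi)
  rw [integral_finsetSum _ hint]
  refine Finset.sum_congr rfl fun i hi => ?_
  rw [← (measurePreserving_delayLaw θ p hi).map_eq,
    integral_map (measurable_pi_apply i).aemeasurable (by fun_prop)]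

/-- The log-likelihood ratio, between the parameters `θ` and `μ`, of the record of a packet. -/
def stepLLR (θ μ : Param E) (x : Step G s t) : ℝ :=
  ∑ i ∈ x.1.links, llr (linkDelay (θ i)) (linkDelay (μ i)) (x.2 i)

lemma integrable_llr_of_KLG_ne_top {u v : Set.Ioc (0 : ℝ) 1} (h : KLG u v ≠ ∞) :
    Integrable (llr (linkDelay u) (linkDelay v)) (linkDelay u) :=
  (InformationTheory.klDiv_ne_top_iff.1 h).2

lemma integrable_stepLLR {θ μ : Param E} (h : ∀ i, KLG (θ i) (μ i) ≠ ∞) (p : G.Path s t) :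
    Integrable (fun y => stepLLR θ μ (p, y)) (delayLaw θ p) :=
  integrable_delayLaw_sum θ p fun i _ => integrable_llr_of_KLG_ne_top (h i)

lemma integral_stepLLR {θ μ : Param E} (h : ∀ i, KLG (θ i) (μ i) ≠ ∞) (p : G.Path s t) :
    ∫ y, stepLLR θ μ (p, y) ∂delayLaw θ p = ∑ i ∈ p.links, (KLG (θ i) (μ i)).toReal := by
  unfold stepLLR
  rw [integral_delayLaw_sum θ p fun i _ => integrable_llr_of_KLG_ne_top (h i)]
  exact Finset.sum_congr rfl fun i _ => integral_llr_linkDelay (h i)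

lemma exp_neg_stepLLR_mul_singleton_le {θ μ : Param E} (h : ∀ i, KLG (θ i) (μ i) ≠ ∞)
    (p : G.Path s t) (y : E → ℕ) :
    ENNReal.ofReal (Real.exp (-stepLLR θ μ (p, y))) * delayLaw θ p {y} ≤ delayLaw μ p {y} := by
  classical
  have hprob (θ : Param E) (i : E) : IsProbabilityMeasure
      (if i ∈ p.links then linkDelay (θ i) else Measure.dirac 0) := by
    split_ifs <;> infer_instance
  have hpi (θ : Param E) : delayLaw θ p {y} =
      ∏ i, (if i ∈ p.links then linkDelay (θ i) else Measure.dirac 0) {y i} := by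
    rw [← Measure.pi_singleton]
    unfold delayLaw
    congr!
  have hexp : ENNReal.ofReal (Real.exp (-stepLLR θ μ (p, y))) = ∏ i, if i ∈ p.links then
      ENNReal.ofReal (Real.exp (-llr (linkDelay (θ i)) (linkDelay (μ i)) (y i))) else 1 := by
    rw [stepLLR, ← Finset.sum_neg_distrib, Real.exp_sum,
      ENNReal.ofReal_prod_of_nonneg fun _ _ => (Real.exp_pos _).le, Finset.prod_ite_mem,
      Finset.univ_inter]
  rw [hpi, hpi, hexp, ← Finset.prod_mul_distrib]
  refine Finset.prod_le_prod' fun i _ => ?_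
  -- Off the path both parameters give the same point mass at 0, so the likelihood factor is 1.
  split_ifs with hi
  · exact exp_neg_llr_mul_singleton_le (InformationTheory.klDiv_ne_top_iff.1 (h i)).1 _
  · simp

/-- As `E` is finite, the delay vectors form a countable set, so the inequality between point masses
can be summed. -/
lemma lintegral_mul_exp_neg_stepLLR_le {θ μ : Param E} (h : ∀ i, KLG (θ i) (μ i) ≠ ∞)
    (p : G.Path s t) (F : (E → ℕ) → ℝ≥0∞) :
    ∫⁻ y, F y * ENNReal.ofReal (Real.exp (-stepLLR θ μ (p, y))) ∂delayLaw θ p ≤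
      ∫⁻ y, F y ∂delayLaw μ p := by
  rw [lintegral_countable', lintegral_countable']
  refine ENNReal.tsum_le_tsum fun y => ?_
  rw [mul_assoc]
  gcongr
  exact exp_neg_stepLLR_mul_singleton_le h p y

/-! ### The law of the records -/

instance (π : Policy G s t) (n : ℕ) : IsMarkovKernel (π.choose n) := π.isMarkov n

/-- The conditional law, given the path, of the record of a packet. -/
def delayKernel (θ : Param E) (n : ℕ) :
    Kernel (History G s t n × G.Path s t) (E → ℕ) :=
  Kernel.ofFunOfCountable fun x => delayLaw θ x.2

instance (θ : Param E) (n : ℕ) : IsMarkovKernel (delayKernel (G := G) (s := s) (t := t) θ n) :=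
  ⟨fun x => inferInstanceAs (IsProbabilityMeasure (delayLaw θ x.2))⟩

lemma stepKernel_eq (θ : Param E) (π : Policy G s t) (n : ℕ) :
    stepKernel θ π n = (π.choose n).compProd (delayKernel θ n) := rfl

instance (θ : Param E) (π : Policy G s t) (n : ℕ) : IsMarkovKernel (stepKernel θ π n) := by
  rw [stepKernel_eq]; infer_instance

instance isProbabilityMeasure_historyLaw (θ : Param E) (π : Policy G s t) (n : ℕ) :
    IsProbabilityMeasure (historyLaw θ π n) := by
  induction n with
  | zero => unfold historyLaw; infer_instance
  | succ n ih =>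
    unfold historyLaw
    exact Measure.isProbabilityMeasure_map (measurable_of_countable _).aemeasurable

lemma lintegral_stepKernel (θ : Param E) (π : Policy G s t) (n : ℕ) (h : History G s t n)
    (F : Step G s t → ℝ≥0∞) :
    ∫⁻ x, F x ∂stepKernel θ π n h =
      ∫⁻ p, ∫⁻ y, F (p, y) ∂delayLaw θ p ∂π.choose n h := by
  rw [stepKernel_eq, Kernel.lintegral_compProd _ _ _ (measurable_of_countable _)]
  rfl

lemma lintegral_historyLaw_succ (θ : Param E) (π : Policy G s t) (n : ℕ)
    (F : History G s t (n + 1) → ℝ≥0∞) :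
    ∫⁻ h, F h ∂historyLaw θ π (n + 1) = ∫⁻ h, ∫⁻ p, ∫⁻ y,
      F (Fin.snoc (α := fun _ => Step G s t) h (p, y))
        ∂delayLaw θ p ∂π.choose n h ∂historyLaw θ π n := by
  rw [historyLaw, lintegral_map (measurable_of_countable _) (measurable_of_countable _),
    Measure.lintegral_compProd (measurable_of_countable _)]
  simp_rw [lintegral_stepKernel]

/-- The log-likelihood ratio, between the parameters `θ` and `μ`, of the records. -/
def historyLLR (θ μ : Param E) {n : ℕ} (h : History G s t n) : ℝ :=
  ∑ k, stepLLR θ μ (h k)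

/-- Change of measure from `θ` to `μ`. -/
lemma lintegral_mul_exp_neg_historyLLR_le {θ μ : Param E} (hKL : ∀ i, KLG (θ i) (μ i) ≠ ∞)
    (π : Policy G s t) (n : ℕ) (F : History G s t n → ℝ≥0∞) :
    ∫⁻ h, F h * ENNReal.ofReal (Real.exp (-historyLLR θ μ h)) ∂historyLaw θ π n ≤
      ∫⁻ h, F h ∂historyLaw μ π n := by
  induction n with
  | zero =>
    simp only [historyLaw, historyLLR, Finset.univ_eq_empty, Finset.sum_empty, neg_zero,
      Real.exp_zero, ENNReal.ofReal_one, mul_one, le_refl]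
  | succ n ih =>
    rw [lintegral_historyLaw_succ, lintegral_historyLaw_succ]
    -- The induction hypothesis is used for the function of the first `n` records obtained by
    -- averaging the last record under `μ`; the kernel `π.choose n` is common to both sides.
    refine le_trans (lintegral_mono fun h => ?_) (ih _)
    rw [← lintegral_mul_const _ (measurable_of_countable _)]
    refine lintegral_mono fun p => ?_
    have hsplit (y : E → ℕ) : ENNReal.ofReal (Real.exp (-historyLLR θ μ
        (Fin.snoc (α := fun _ => Step G s t) h (p, y)))) =
        ENNReal.ofReal (Real.exp (-stepLLR θ μ (p, y))) *
          ENNReal.ofReal (Real.exp (-historyLLR θ μ h)) := by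
      rw [← ENNReal.ofReal_mul (Real.exp_pos _).le, ← Real.exp_add, historyLLR,
        Fin.sum_univ_castSucc]
      simp only [Fin.snoc_castSucc, Fin.snoc_last, historyLLR]
      congr 2; ring
    simp_rw [hsplit, ← mul_assoc]
    rw [lintegral_mul_const _ (measurable_of_countable _)]
    exact mul_le_mul' (lintegral_mul_exp_neg_stepLLR_le hKL p _) le_rfl

/-- The law of the path of the packet after the first `n` packets. -/
def pathLaw (θ : Param E) (π : Policy G s t) (n : ℕ) : Measure (G.Path s t) :=
  (historyLaw θ π n).bind (π.choose n)

instance (θ : Param E) (π : Policy G s t) (n : ℕ) : IsProbabilityMeasure (pathLaw θ π n) := by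
  unfold pathLaw; infer_instance

/-- Later records integrate out to 1, so the law of record `k` does not depend on the horizon `n`.
-/
lemma lintegral_historyLaw_eval (θ : Param E) (π : Policy G s t) {n : ℕ} (k : Fin n)
    (F : Step G s t → ℝ≥0∞) :
    ∫⁻ h, F (h k) ∂historyLaw θ π n =
      ∫⁻ p, ∫⁻ y, F (p, y) ∂delayLaw θ p ∂pathLaw θ π k := by
  induction n with
  | zero => exact k.elim0
  | succ n ih =>
    rw [lintegral_historyLaw_succ]
    induction k using Fin.lastCases with
    | last =>
      simp only [Fin.snoc_last, Fin.val_last]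
      rw [pathLaw, Measure.lintegral_bind (Kernel.aemeasurable _)
        (measurable_of_countable _).aemeasurable]
    | cast k =>
      simp only [Fin.snoc_castSucc, lintegral_const, measure_univ, mul_one, Fin.val_castSucc]
      exact ih k

/-- The law of a record. -/
def stepLaw (θ : Param E) (π : Policy G s t) (n : ℕ) : Measure (Step G s t) :=
  pathLaw θ π n ⊗ₘ Kernel.ofFunOfCountable (delayLaw θ)

lemma map_eval_historyLaw (θ : Param E) (π : Policy G s t) {n : ℕ} (k : Fin n) :
    (historyLaw θ π n).map (fun h => h k) = stepLaw θ π k := by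
  have : IsMarkovKernel (Kernel.ofFunOfCountable (delayLaw (G := G) (s := s) (t := t) θ)) :=
    ⟨fun x => inferInstanceAs (IsProbabilityMeasure (delayLaw θ x))⟩
  refine Measure.ext_of_lintegral _ fun F hF => ?_
  rw [lintegral_map hF (measurable_pi_apply k), lintegral_historyLaw_eval, stepLaw,
    Measure.lintegral_compProd hF]
  rfl

/-! ### Expected counts, and the regret in terms of them -/

/-- The expected number of packets sent on the path `p` among the first `N` packets. -/
def expectedCount (θ : Param E) (π : Policy G s t) (p : G.Path s t) (N : ℕ) : ℝ :=
  ∑ k ∈ Finset.range N, (pathLaw θ π k).real {p}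

lemma integrable_stepLaw {θ : Param E} (π : Policy G s t) {φ : Step G s t → ℝ}
    (hφ : ∀ p, Integrable (fun y => φ (p, y)) (delayLaw θ p)) (k : ℕ) :
    Integrable φ (stepLaw θ π k) := by
  have : IsMarkovKernel (Kernel.ofFunOfCountable (delayLaw (G := G) (s := s) (t := t) θ)) :=
    ⟨fun x => inferInstanceAs (IsProbabilityMeasure (delayLaw θ x))⟩
  rw [stepLaw, Measure.integrable_compProd_iff (by fun_prop)]
  exact ⟨Eventually.of_forall hφ, Integrable.of_finite⟩

lemma integral_stepLaw {θ : Param E} (π : Policy G s t) {φ : Step G s t → ℝ}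
    (hφ : ∀ p, Integrable (fun y => φ (p, y)) (delayLaw θ p)) (k : ℕ) :
    ∫ x, φ x ∂stepLaw θ π k =
      ∑ p, (pathLaw θ π k).real {p} * ∫ y, φ (p, y) ∂delayLaw θ p := by
  have : IsMarkovKernel (Kernel.ofFunOfCountable (delayLaw (G := G) (s := s) (t := t) θ)) :=
    ⟨fun x => inferInstanceAs (IsProbabilityMeasure (delayLaw θ x))⟩
  have hint := integrable_stepLaw π hφ k
  rw [stepLaw] at hint ⊢
  rw [Measure.integral_compProd hint, integral_fintype Integrable.of_finite]
  rfl

lemma integrable_eval_historyLaw {θ : Param E} (π : Policy G s t) {φ : Step G s t → ℝ}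
    (hφ : ∀ p, Integrable (fun y => φ (p, y)) (delayLaw θ p)) {N : ℕ} (k : Fin N) :
    Integrable (fun h => φ (h k)) (historyLaw θ π N) := by
  have h := integrable_stepLaw π hφ k
  rw [← map_eval_historyLaw θ π k] at h
  exact h.comp_measurable (measurable_pi_apply k)

lemma integrable_sum_historyLaw {θ : Param E} (π : Policy G s t) {φ : Step G s t → ℝ}
    (hφ : ∀ p, Integrable (fun y => φ (p, y)) (delayLaw θ p)) (N : ℕ) :
    Integrable (fun h => ∑ k : Fin N, φ (h k)) (historyLaw θ π N) :=
  integrable_finsetSum _ fun k _ => integrable_eval_historyLaw π hφ k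

/-- A Wald-type identity: given its path, a record has a law independent of the past. It serves for
delays, indicators of paths and log-likelihood ratios alike. -/
lemma integral_sum_historyLaw {θ : Param E} (π : Policy G s t) {φ : Step G s t → ℝ}
    (hφ : ∀ p, Integrable (fun y => φ (p, y)) (delayLaw θ p)) (N : ℕ) :
    ∫ h, ∑ k : Fin N, φ (h k) ∂historyLaw θ π N =
      ∑ p, expectedCount θ π p N * ∫ y, φ (p, y) ∂delayLaw θ p := by
  rw [integral_finsetSum]
  · have (k : Fin N) : ∫ h, φ (h k) ∂historyLaw θ π N =
        ∑ p, (pathLaw θ π k).real {p} * ∫ y, φ (p, y) ∂delayLaw θ p := by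
      rw [← integral_stepLaw π hφ, ← map_eval_historyLaw θ π k,
        integral_map (measurable_pi_apply k).aemeasurable (by fun_prop)]
    simp_rw [this, expectedCount, Finset.sum_mul]
    rw [Finset.sum_comm]
    refine Finset.sum_congr rfl fun p _ => ?_
    exact Fin.sum_univ_eq_sum_range
      (fun k => (pathLaw θ π k).real {p} * ∫ y, φ (p, y) ∂delayLaw θ p) N
  · exact fun k _ => integrable_eval_historyLaw π hφ k

lemma expectedCount_nonneg (θ : Param E) (π : Policy G s t) (p : G.Path s t) (N : ℕ) :
    0 ≤ expectedCount θ π p N :=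
  Finset.sum_nonneg fun _ _ => measureReal_nonneg

lemma sum_expectedCount (θ : Param E) (π : Policy G s t) (N : ℕ) :
    ∑ p, expectedCount θ π p N = N := by
  have h := integral_sum_historyLaw (θ := θ) π (φ := fun _ => 1)
    (fun p => integrable_const _) N
  simpa using h.symm

lemma regret_eq (θ : Param E) (pstar : G.Path s t) (π : Policy G s t) (N : ℕ) :
    regret θ pstar π N =
      ∑ p, expectedCount θ π p N * (meanDelay θ p - meanDelay θ pstar) := by
  have hint (p : G.Path s t) (i : E) (_ : i ∈ p.links) :
      Integrable (fun k : ℕ => (k : ℝ)) (linkDelay (θ i)) := integrable_linkDelay_id _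
  have h := integral_sum_historyLaw (θ := θ) π
    (φ := fun x => ∑ i ∈ x.1.links, (x.2 i : ℝ))
    (fun p => integrable_delayLaw_sum θ p (hint p)) N
  rw [regret, h]
  simp_rw [mul_sub]
  rw [Finset.sum_sub_distrib, ← Finset.sum_mul, sum_expectedCount]
  congr 1
  refine Finset.sum_congr rfl fun p _ => ?_
  rw [integral_delayLaw_sum θ p (hint p), meanDelay]
  simp_rw [integral_linkDelay_id]

open Classical in
lemma expectedSuboptimal_eq (θ : Param E) (π : Policy G s t) (N : ℕ) :
    expectedSuboptimal θ π N =
      ∑ p, expectedCount θ π p N * if Suboptimal θ p then 1 else 0 := by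
  have h := integral_sum_historyLaw (θ := θ) π
    (φ := fun x => if Suboptimal θ x.1 then 1 else 0)
    (fun p => integrable_const (if Suboptimal θ p then (1 : ℝ) else 0)) N
  rw [expectedSuboptimal]
  simp only [Finset.card_filter]
  push_cast
  refine h.trans (Finset.sum_congr rfl fun p _ => congrArg _ ?_)
  exact (integral_const (if Suboptimal θ p then (1 : ℝ) else 0)).trans (by simp)

lemma expectedCount_le_expectedSuboptimal {θ : Param E} (π : Policy G s t) {p : G.Path s t}
    (hp : Suboptimal θ p) (N : ℕ) : expectedCount θ π p N ≤ expectedSuboptimal θ π N := by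
  classical
  rw [expectedSuboptimal_eq]
  refine le_trans (by simp [hp]) (Finset.single_le_sum (f := fun q =>
    expectedCount θ π q N * if Suboptimal θ q then 1 else 0) (fun q _ => ?_) (Finset.mem_univ p))
  exact mul_nonneg (expectedCount_nonneg _ _ _ _) (by split_ifs <;> simp)

lemma le_expectedCount_add_expectedSuboptimal {θ : Param E} (π : Policy G s t)
    {pstar : G.Path s t} (h : ∀ p, p ≠ pstar → meanDelay θ pstar < meanDelay θ p) (N : ℕ) :
    (N : ℝ) ≤ expectedCount θ π pstar N + expectedSuboptimal θ π N := by
  classical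
  rw [expectedSuboptimal_eq, ← sum_expectedCount θ π N, ← Finset.add_sum_erase _ _
    (Finset.mem_univ pstar), add_le_add_iff_left]
  refine le_trans (Finset.sum_le_sum fun p hp => ?_)
    (Finset.sum_le_sum_of_subset_of_nonneg (Finset.erase_subset pstar _) fun q _ _ => ?_)
  · rw [if_pos ⟨pstar, h p (Finset.ne_of_mem_erase hp)⟩, mul_one]
  · exact mul_nonneg (expectedCount_nonneg _ _ _ _) (by split_ifs <;> simp)

end Law

section LowerBound

variable {V E : Type*} {G : Network V E} {s t : V}

/-! ### The information inequality -/

/-- The information about `θ` against `μ` gathered by a packet sent on the path `p`. -/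
def pathInfo (θ μ : Param E) (p : G.Path s t) : ℝ :=
  ∑ i ∈ p.links, (KLG (θ i) (μ i)).toReal

lemma pathInfo_eq_zero {θ μ : Param E} {pstar : G.Path s t} (hμ : μ ∈ badParams θ pstar) :
    pathInfo θ μ pstar = 0 :=
  Finset.sum_eq_zero fun i hi => by rw [hμ.1 i hi, KLG_self, ENNReal.toReal_zero]

open Classical in
/-- The number of packets sent on the path `p`. -/
def pathCount (p : G.Path s t) {N : ℕ} (h : History G s t N) : ℝ :=
  ∑ k, if (h k).1 = p then 1 else 0

lemma pathCount_nonneg (p : G.Path s t) {N : ℕ} (h : History G s t N) : 0 ≤ pathCount p h :=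
  Finset.sum_nonneg fun _ _ => by split_ifs <;> simp

lemma pathCount_le (p : G.Path s t) {N : ℕ} (h : History G s t N) : pathCount p h ≤ N := by
  refine (Finset.sum_le_card_nsmul _ _ 1 fun k _ => ?_).trans (by simp)
  split_ifs <;> simp

variable [Fintype E]

lemma integrable_pathCount (θ : Param E) (π : Policy G s t) (p : G.Path s t) (N : ℕ) :
    Integrable (pathCount p) (historyLaw θ π N) := by
  classical
  exact integrable_sum_historyLaw π (φ := fun x => if x.1 = p then 1 else 0)
    (fun q => integrable_const (if q = p then (1 : ℝ) else 0)) N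

lemma integral_pathCount (θ : Param E) (π : Policy G s t) (p : G.Path s t) (N : ℕ) :
    ∫ h, pathCount p h ∂historyLaw θ π N = expectedCount θ π p N := by
  classical
  have h := integral_sum_historyLaw (θ := θ) π (φ := fun x => if x.1 = p then 1 else 0)
    (fun q => integrable_const (if q = p then (1 : ℝ) else 0)) N
  have hq (q : G.Path s t) : ∫ _, (if q = p then (1 : ℝ) else 0) ∂delayLaw θ q =
      if q = p then 1 else 0 := (integral_const _).trans (by simp)
  have h' : ∫ h, pathCount p h ∂historyLaw θ π N = ∑ q, expectedCount θ π q N *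
      ∫ _, (if q = p then (1 : ℝ) else 0) ∂delayLaw θ q := h
  rw [h']
  simp_rw [hq]
  simp

lemma integrable_historyLLR {θ μ : Param E} (hKL : ∀ i, KLG (θ i) (μ i) ≠ ∞)
    (π : Policy G s t) (N : ℕ) : Integrable (historyLLR θ μ) (historyLaw θ π N) :=
  integrable_sum_historyLaw π (integrable_stepLLR hKL) N

lemma integral_historyLLR {θ μ : Param E} (hKL : ∀ i, KLG (θ i) (μ i) ≠ ∞)
    (π : Policy G s t) (N : ℕ) :
    ∫ h, historyLLR θ μ h ∂historyLaw θ π N =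
      ∑ p, expectedCount θ π p N * pathInfo θ μ p := by
  refine (integral_sum_historyLaw π (integrable_stepLLR hKL) N).trans ?_
  simp_rw [integral_stepLLR hKL, pathInfo]

/-- A form of the Donsker-Varadhan inequality for the number of packets sent on a path. -/
lemma mul_expectedCount_le {θ μ : Param E} (hKL : ∀ i, KLG (θ i) (μ i) ≠ ∞)
    (π : Policy G s t) (q : G.Path s t) {N : ℕ} (hN : 0 < N) {c : ℝ} (hc : 0 ≤ c) :
    c * (expectedCount θ π q N / N) ≤ (∑ p, expectedCount θ π p N * pathInfo θ μ p) +
      (Real.exp c - 1) * (expectedCount μ π q N / N) := by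
  have hN' : (0 : ℝ) < N := Nat.cast_pos.2 hN
  have hec : 0 ≤ Real.exp c - 1 := by linarith [Real.add_one_le_exp c]
  -- The chord of `exp (c * x)` over `[0, 1]`, at `x = pathCount q h / N`. It bounds the exponential
  -- from above, and being affine in the count its mean under `μ` involves only the expected count.
  set W : History G s t N → ℝ := fun h => 1 + (Real.exp c - 1) * (pathCount q h / N) with hW
  have hW1 (h : History G s t N) : 0 ≤ W h := by
    have := pathCount_nonneg q h
    simp only [hW]; positivity
  have hWint : Integrable W (historyLaw μ π N) :=
    (integrable_const 1).add (((integrable_pathCount μ π q N).div_const _).const_mul _)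
  have hWval : ∫ h, W h ∂historyLaw μ π N =
      1 + (Real.exp c - 1) * (expectedCount μ π q N / N) := by
    rw [hW, integral_add (integrable_const 1)
      (((integrable_pathCount μ π q N).div_const _).const_mul _), integral_const_mul,
      integral_div, integral_pathCount]
    simp
  have hpoint (h : History G s t N) :
      c * (pathCount q h / N) - historyLLR θ μ h + 1 ≤
        W h * Real.exp (-historyLLR θ μ h) := by
    have h0 : 0 ≤ pathCount q h / N := div_nonneg (pathCount_nonneg q h) hN'.le
    have h1 : pathCount q h / N ≤ 1 := (div_le_one hN').2 (pathCount_le q h)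
    have hconv : Real.exp (c * (pathCount q h / N)) ≤ W h := by
      have := convexOn_exp.2 (Set.mem_univ c) (Set.mem_univ 0) h0 (sub_nonneg.2 h1) (by ring)
      simp only [smul_eq_mul, mul_zero, add_zero, Real.exp_zero, mul_one] at this
      rw [mul_comm c]
      simp only [hW]
      linarith
    calc c * (pathCount q h / N) - historyLLR θ μ h + 1
        ≤ Real.exp (c * (pathCount q h / N) - historyLLR θ μ h) := Real.add_one_le_exp _
      _ = Real.exp (c * (pathCount q h / N)) * Real.exp (-historyLLR θ μ h) := by
        rw [← Real.exp_add, sub_eq_add_neg]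
      _ ≤ _ := mul_le_mul_of_nonneg_right hconv (Real.exp_pos _).le
  have hlin : ∫⁻ h, ENNReal.ofReal (W h * Real.exp (-historyLLR θ μ h)) ∂historyLaw θ π N ≤
      ENNReal.ofReal (∫ h, W h ∂historyLaw μ π N) := by
    rw [ofReal_integral_eq_lintegral_ofReal hWint (Eventually.of_forall hW1)]
    simp_rw [ENNReal.ofReal_mul (hW1 _)]
    exact lintegral_mul_exp_neg_historyLLR_le hKL π N _
  have hnn : ∀ h : History G s t N, 0 ≤ W h * Real.exp (-historyLLR θ μ h) := fun h =>
    mul_nonneg (hW1 h) (Real.exp_pos _).le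
  -- Integrability under `θ` comes from the change of measure itself, as `W` is integrable under
  -- `μ`.
  have hRint : Integrable (fun h => W h * Real.exp (-historyLLR θ μ h)) (historyLaw θ π N) :=
    ⟨by fun_prop, (hasFiniteIntegral_iff_ofReal (Eventually.of_forall hnn)).2
      (hlin.trans_lt ENNReal.ofReal_lt_top)⟩
  have hR : ∫ h, W h * Real.exp (-historyLLR θ μ h) ∂historyLaw θ π N ≤
      ∫ h, W h ∂historyLaw μ π N := by
    rw [← ofReal_integral_eq_lintegral_ofReal hRint (Eventually.of_forall hnn)] at hlin
    exact (ENNReal.ofReal_le_ofReal_iff (integral_nonneg hW1)).1 hlin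
  have hTint := ((integrable_pathCount θ π q N).div_const (N : ℝ)).const_mul c
  have hLint := integrable_historyLLR hKL π N
  have hmono := integral_mono ((hTint.sub hLint).add (integrable_const 1)) hRint hpoint
  have hL : ∫ h, (c * (pathCount q h / N) - historyLLR θ μ h + 1) ∂historyLaw θ π N =
      c * (expectedCount θ π q N / N) - (∑ p, expectedCount θ π p N * pathInfo θ μ p) + 1 := by
    have hsub : Integrable (fun h => c * (pathCount q h / N) - historyLLR θ μ h)
        (historyLaw θ π N) := hTint.sub hLint
    rw [integral_add hsub (integrable_const 1), integral_sub hTint hLint,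
      integral_const_mul, integral_div, integral_pathCount, integral_historyLLR hKL]
    simp
  have := hL.symm.trans_le (hmono.trans (hR.trans_eq hWval))
  linarith

/-- Under a uniformly good policy, the information against a bad parameter grows at least
like `log N`. -/
lemma exists_lower_bound_info {θ μ : Param E} {pstar : G.Path s t} {π : Policy G s t}
    (hπ : UniformlyGood π)
    (hpstar : ∀ p : G.Path s t, p ≠ pstar → meanDelay θ pstar < meanDelay θ p)
    (hμ : μ ∈ badParams θ pstar) (hKL : ∀ i, KLG (θ i) (μ i) ≠ ∞) {α : ℝ} (hα0 : 0 < α)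
    (hα1 : α < 1) :
    ∃ r : ℕ → ℝ, Tendsto r atTop (𝓝 (1 - α)) ∧ ∀ᶠ N : ℕ in atTop,
      r N ≤ (∑ p, expectedCount θ π p N * pathInfo θ μ p) / Real.log N := by
  -- Under `θ` exponent 1 is enough: the suboptimal fraction tends to 0. Under `μ` the exponent `α`
  -- matters.
  have hθlim := (hπ θ 1 one_pos).tendsto_div_nhds_zero
  have hμlim := (hπ μ α hα0).tendsto_div_nhds_zero
  have hlog : Tendsto (fun N : ℕ => Real.log N) atTop atTop :=
    Real.tendsto_log_atTop.comp tendsto_natCast_atTop_atTop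
  refine ⟨fun N => (1 - α) * (1 - expectedSuboptimal θ π N / (N : ℝ) ^ (1 : ℝ)) -
    expectedSuboptimal μ π N / (N : ℝ) ^ α * (Real.log N)⁻¹, ?_, ?_⟩
  · simpa using ((tendsto_const_nhds (x := (1 : ℝ))).sub hθlim).const_mul (1 - α) |>.sub
      (hμlim.mul hlog.inv_tendsto_atTop)
  filter_upwards [eventually_gt_atTop 0, hlog.eventually_gt_atTop 0] with N hN hlogN
  have hN' : (0 : ℝ) < N := Nat.cast_pos.2 hN
  have hsub : Suboptimal μ pstar := hμ.2
  -- With `c = (1 - α) log N`, `exp c / N = N ^ (-α)`, which exactly offsets the `o(N ^ α)` count of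
  -- `pstar` under `μ`.
  have key := mul_expectedCount_le hKL π pstar hN
    (mul_nonneg (sub_pos.2 hα1).le hlogN.le)
  have hexp : Real.exp ((1 - α) * Real.log N) = N / (N : ℝ) ^ α := by
    rw [mul_comm, ← Real.rpow_def_of_pos hN', Real.rpow_sub hN', Real.rpow_one]
  have h1 : (Real.exp ((1 - α) * Real.log N) - 1) * (expectedCount μ π pstar N / N) ≤
      expectedSuboptimal μ π N / (N : ℝ) ^ α := by
    have hS := expectedCount_le_expectedSuboptimal π hsub N
    have hC := expectedCount_nonneg μ π pstar N
    have hpow : 0 < (N : ℝ) ^ α := Real.rpow_pos_of_pos hN' α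
    calc (Real.exp ((1 - α) * Real.log N) - 1) * (expectedCount μ π pstar N / N)
        ≤ Real.exp ((1 - α) * Real.log N) * (expectedCount μ π pstar N / N) := by
          gcongr; linarith
      _ = expectedCount μ π pstar N / (N : ℝ) ^ α := by
          rw [hexp]; field_simp
      _ ≤ _ := by gcongr
  have h2 : 1 - expectedSuboptimal θ π N / (N : ℝ) ^ (1 : ℝ) ≤
      expectedCount θ π pstar N / N := by
    rw [Real.rpow_one, one_sub_div hN'.ne']
    gcongr
    linarith [le_expectedCount_add_expectedSuboptimal π hpstar N]
  have h3 := mul_le_mul_of_nonneg_left h2 (mul_nonneg (sub_pos.2 hα1).le hlogN.le)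
  rw [le_div_iff₀ hlogN, sub_mul, mul_assoc (_ / _), inv_mul_cancel₀ hlogN.ne']
  linarith

/-! ### Feasibility -/

lemma meanDelay_le_add {μ μ' : Param E} {δ : ℝ} (hδ : 0 ≤ δ)
    (h : ∀ i, 1 / (μ' i : ℝ) ≤ 1 / (μ i : ℝ) + δ) (p : G.Path s t) :
    meanDelay μ' p ≤ meanDelay μ p + Fintype.card E * δ := by
  unfold meanDelay
  refine (Finset.sum_le_sum fun i _ => h i).trans ?_
  rw [Finset.sum_add_distrib, Finset.sum_const, nsmul_eq_mul]
  gcongr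
  exact Finset.card_le_univ _

/-- A bad parameter is close to one with finite divergences, which agrees with it wherever the
divergence is finite. -/
lemma exists_badParams_KLG_ne_top {θ μ : Param E} {pstar : G.Path s t}
    (hμ : μ ∈ badParams θ pstar) :
    ∃ μ' ∈ badParams θ pstar, (∀ i, KLG (θ i) (μ' i) ≠ ∞) ∧
      ∀ i, KLG (θ i) (μ i) ≠ ∞ → μ' i = μ i := by
  classical
  obtain ⟨hagree, p, hp⟩ := hμ
  have hlim : Tendsto (fun v : ℝ => meanDelay μ p + Fintype.card E * (1 / v - 1)) (𝓝[<] 1)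
      (𝓝 (meanDelay μ p)) := by
    have : ContinuousAt (fun v : ℝ => meanDelay μ p + Fintype.card E * (1 / v - 1)) 1 := by
      fun_prop (disch := norm_num)
    simpa using this.tendsto.mono_left nhdsWithin_le_nhds
  have hpos : ∀ᶠ v : ℝ in 𝓝[<] 1, 0 < v :=
    (eventually_gt_nhds one_pos).filter_mono nhdsWithin_le_nhds
  -- Badness is a strict inequality, so it survives the replacement of some `μ i` by a `v < 1` close
  -- enough to 1. As `1 / μ i ≥ 1`, each such change adds at most `1 / v - 1` to the delay.
  obtain ⟨v, hv, hv0, hv1⟩ := ((hlim.eventually (gt_mem_nhds hp)).and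
    (hpos.and self_mem_nhdsWithin)).exists
  have hv1' : v < 1 := hv1
  let w : Set.Ioc (0 : ℝ) 1 := ⟨v, hv0, hv1'.le⟩
  have hδ : 0 ≤ 1 / v - 1 := sub_nonneg.2 ((le_div_iff₀ hv0).2 (by linarith))
  let μ' : Param E := fun i => if KLG (θ i) (μ i) = ∞ then w else μ i
  have hμ' (i : E) (hi : KLG (θ i) (μ i) ≠ ∞) : μ' i = μ i := if_neg hi
  have hstar (i : E) (hi : i ∈ pstar.links) : μ' i = θ i := by
    have h := hagree i hi
    rw [← h]
    exact hμ' i (by rw [h, KLG_self]; exact ENNReal.zero_ne_top)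
  have hmstar : meanDelay μ' pstar = meanDelay μ pstar :=
    Finset.sum_congr rfl fun i hi => by rw [hstar i hi, hagree i hi]
  refine ⟨μ', ⟨hstar, p, ?_⟩, fun i => ?_, hμ'⟩
  · rw [hmstar]
    refine (meanDelay_le_add hδ (fun i => ?_) p).trans_lt hv
    by_cases hi : KLG (θ i) (μ i) = ∞
    · have : μ' i = w := if_pos hi
      rw [this]
      have := (one_le_div (μ i).2.1).2 (μ i).2.2
      change 1 / v ≤ _
      linarith
    · rw [hμ' i hi]; linarith
  · by_cases hi : KLG (θ i) (μ i) = ∞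
    · have : μ' i = w := if_pos hi
      rw [this]
      exact KLG_ne_top hv1'
    · rwa [hμ' i hi]

/-- It suffices to check feasibility for the bad parameters with finite divergences. -/
lemma feasible_of_pathInfo {θ : Param E} {pstar : G.Path s t} {x : G.Path s t → ℝ≥0}
    (h : ∀ μ ∈ badParams θ pstar, (∀ i, KLG (θ i) (μ i) ≠ ∞) →
      1 ≤ ∑ p, (x p : ℝ) * pathInfo θ μ p) : Feasible θ pstar x := by
  classical
  refine le_iInf₂ fun μ hμ => ?_
  obtain ⟨μ', hμ', hKL, hagree⟩ := exists_badParams_KLG_ne_top hμ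
  have h1 := ENNReal.ofReal_le_ofReal (h μ' hμ' hKL)
  have hnn (p : G.Path s t) : 0 ≤ (x p : ℝ) * pathInfo θ μ' p :=
    mul_nonneg (x p).coe_nonneg (Finset.sum_nonneg fun _ _ => ENNReal.toReal_nonneg)
  rw [ENNReal.ofReal_one, ENNReal.ofReal_sum_of_nonneg fun p _ => hnn p] at h1
  refine h1.trans ?_
  rw [← Finset.sum_filter_add_sum_filter_not Finset.univ (fun p => p ≠ pstar)]
  have hzero : ∑ p ∈ Finset.univ.filter (fun p => ¬ p ≠ pstar),
      ENNReal.ofReal ((x p : ℝ) * pathInfo θ μ' p) = 0 := by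
    refine Finset.sum_eq_zero fun p hp => ?_
    have : p = pstar := by simpa using hp
    rw [this, pathInfo_eq_zero hμ', mul_zero, ENNReal.ofReal_zero]
  rw [hzero, add_zero]
  refine le_trans (Finset.sum_le_sum fun p _ => ?_) (le_of_eq (by congr!))
  have hinfo : ENNReal.ofReal (pathInfo θ μ' p) = ∑ i ∈ p.links, KLG (θ i) (μ' i) := by
    rw [pathInfo, ENNReal.ofReal_sum_of_nonneg fun _ _ => ENNReal.toReal_nonneg]
    exact Finset.sum_congr rfl fun i _ => ENNReal.ofReal_toReal (hKL i)
  rw [ENNReal.ofReal_mul (x p).coe_nonneg, ENNReal.ofReal_coe_nnreal, hinfo]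
  refine mul_le_mul' le_rfl (Finset.sum_le_sum fun i _ => ?_)
  -- Link by link the divergence of `μ'` is at most that of `μ`: either the latter is infinite or
  -- the parameters agree.
  by_cases hi : KLG (θ i) (μ i) = ∞
  · rw [hi]; exact le_top
  · rw [hagree i hi]

/-! ### The lower bound -/

/-- Positive gaps turn a bound on the cost into a bound on every normalised count off `pstar`. A
subsequence therefore converges, and the limit keeps the cost bound and inherits the information
constraints. -/
theorem lowerBoundConst_le_of_frequently {θ : Param E} {pstar : G.Path s t}
    (hpstar : ∀ p : G.Path s t, p ≠ pstar → meanDelay θ pstar < meanDelay θ p)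
    {π : Policy G s t} (hπ : UniformlyGood π) {c : ℝ}
    (hc : ∃ᶠ N : ℕ in atTop, regret θ pstar π N / Real.log N ≤ c) :
    lowerBoundConst θ pstar ≤ c := by
  classical
  set Δ : G.Path s t → ℝ := fun p => meanDelay θ p - meanDelay θ pstar
  have hΔstar : Δ pstar = 0 := sub_self _
  have hΔpos (p : G.Path s t) (hp : p ≠ pstar) : 0 < Δ p := sub_pos.2 (hpstar p hp)
  -- The coordinate of `pstar`, whose count is of order `N`, would be unbounded. Setting it to 0 is
  -- harmless, since its gap and its information against bad parameters vanish.
  set X : ℕ → G.Path s t → ℝ := fun N p =>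
    if p = pstar then 0 else expectedCount θ π p N / Real.log N with hX
  set K : Set (G.Path s t → ℝ) :=
    Set.Ici 0 ∩ ({x | x pstar = 0} ∩ {x | ∑ p, x p * Δ p ≤ c})
  have hKclosed : IsClosed K :=
    isClosed_Ici.inter ((isClosed_eq (continuous_apply _) continuous_const).inter
      (isClosed_le (by fun_prop) continuous_const))
  -- At `pstar` the bound `c / Δ p` is `c / 0 = 0`, consistent with `x pstar = 0`.
  have hKbdd : Bornology.IsBounded K := by
    refine (Metric.isBounded_Icc (0 : G.Path s t → ℝ) fun p => c / Δ p).subset ?_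
    rintro x ⟨h0, hs, hsum⟩
    refine ⟨h0, fun p => ?_⟩
    rcases eq_or_ne p pstar with rfl | hp
    · simpa [hΔstar] using hs.le
    · rw [le_div_iff₀ (hΔpos p hp)]
      refine le_trans ?_ hsum
      refine Finset.single_le_sum (f := fun q => x q * Δ q) (fun q _ => ?_) (Finset.mem_univ p)
      rcases eq_or_ne q pstar with rfl | hq
      · simp [hΔstar]
      · exact mul_nonneg (h0 q) (hΔpos q hq).le
  have hlog : Tendsto (fun N : ℕ => Real.log N) atTop atTop :=
    Real.tendsto_log_atTop.comp tendsto_natCast_atTop_atTop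
  have hXsum (N : ℕ) {f : G.Path s t → ℝ} (hf : f pstar = 0) :
      ∑ p, X N p * f p = (∑ p, expectedCount θ π p N * f p) / Real.log N := by
    rw [Finset.sum_div]
    refine Finset.sum_congr rfl fun p _ => ?_
    rcases eq_or_ne p pstar with rfl | hp
    · simp [hf]
    · simp only [hX, if_neg hp]; ring
  have hXK : ∃ᶠ N : ℕ in atTop, X N ∈ K := by
    refine (hc.and_eventually (hlog.eventually_gt_atTop 0)).mono fun N hN => ?_
    refine ⟨fun p => ?_, by simp [hX], ?_⟩
    · simp only [hX]
      split_ifs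
      · exact le_rfl
      · exact div_nonneg (expectedCount_nonneg _ _ _ _) hN.2.le
    · rw [Set.mem_ofPred_eq, hXsum N hΔstar, ← regret_eq]
      exact hN.1
  -- The subsequence is fixed before `μ` and `α`: the lower bound on the information holds for all
  -- large `N`, so one limit `x` serves every bad parameter.
  obtain ⟨x, hx, φ, hφ, hlim⟩ := tendsto_subseq_of_frequently_bounded hKbdd hXK
  rw [hKclosed.closure_eq] at hx
  obtain ⟨hx0, -, hxc⟩ := hx
  have hfeas : Feasible θ pstar fun p => ⟨x p, hx0 p⟩ := by
    refine feasible_of_pathInfo fun μ hμ hKL => ?_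
    have hinfo : Tendsto (fun n => ∑ p, X (φ n) p * pathInfo θ μ p) atTop
        (𝓝 (∑ p, x p * pathInfo θ μ p)) :=
      tendsto_finsetSum _ fun p _ => ((tendsto_pi_nhds.1 hlim) p).mul_const _
    have hα : ∀ᶠ α : ℝ in 𝓝[>] 0, 1 - α ≤ ∑ p, x p * pathInfo θ μ p := by
      filter_upwards [Ioo_mem_nhdsGT (zero_lt_one' ℝ)] with α hα
      obtain ⟨r, hr, hle⟩ := exists_lower_bound_info hπ hpstar hμ hKL hα.1 hα.2
      refine le_of_tendsto_of_tendsto (hr.comp hφ.tendsto_atTop) hinfo ?_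
      filter_upwards [hφ.tendsto_atTop.eventually hle] with n hn
      rw [hXsum _ (pathInfo_eq_zero hμ)]
      exact hn
    have hone : Tendsto (fun α : ℝ => 1 - α) (𝓝[>] 0) (𝓝 1) := by
      have : ContinuousAt (fun α : ℝ => 1 - α) 0 := by fun_prop
      simpa using this.tendsto.mono_left nhdsWithin_le_nhds
    exact le_of_tendsto hone hα
  exact (iInf₂_le _ hfeas).trans (EReal.coe_le_coe_iff.2 hxc)

end LowerBound

end OnlineRouting

end

theorem theorem2 {V E : Type*} [Fintype E] (G : OnlineRouting.Network V E) (s t : V)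
    (θ : OnlineRouting.Param E) (pstar : G.Path s t)
    (hpstar : ∀ p : G.Path s t, p ≠ pstar →
      OnlineRouting.meanDelay θ pstar < OnlineRouting.meanDelay θ p)
    (π : OnlineRouting.Policy G s t) (hπ : OnlineRouting.UniformlyGood π) :
    OnlineRouting.lowerBoundConst θ pstar ≤
      Filter.liminf (fun N : ℕ =>
        ((OnlineRouting.regret θ pstar π N / Real.log N : ℝ) : EReal)) Filter.atTop := by
  refine le_of_forall_gt fun b hb => ?_
  -- A real `c` strictly above the liminf bounds the normalised regret for infinitely many `N`.
  obtain ⟨c, hc, hcb⟩ := EReal.lt_iff_exists_real_btwn.1 hb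
  refine (OnlineRouting.lowerBoundConst_le_of_frequently hpstar hπ ?_).trans_lt hcb
  exact (frequently_lt_of_liminf_lt (by isBoundedDefault) hc).mono
    fun N hN => (EReal.coe_lt_coe_iff.1 hN).le
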